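/- Consider a finite set of agents $\mathcal N$ with combination weights $a_{\ell k}\ge 0$ (the weight agent $k$ gives to agent $\ell$), $\sum_{\ell}a_{\ell k}=1$ for every $k$. The network is weakly connected: the agents are partitioned into sending sub-networks $1,\dots,S$ and receiving sub-networks $S+1,\dots,S+R$ ($R\ge 0$), where $a_{\ell k}=0$ if $k$ is in a sending sub-network and $\ell$ is not in the same sub-network, or if $k,\ell$ are in receiving sub-networks $r<r'$ respectively; each sending sub-network is strongly connected (any two of its agents are joined, in both directions, by a path inside it of positive weights, and at least one of its agents has $a_{kk}>0$), and any two agents of a receiving sub-network are joined, in both directions, by a path inside it. Let $\Theta$ be a finite set of states, and let agent $k$ have a finite signal space $Z_k$ and likelihoods $L_k(\cdot|\theta)$, $\theta\in\Theta$, which are probability mass functions on $Z_k$. Each sub-network has a true state in $\Theta$; at each time $i\ge1$ every agent $k$ observes a random signal $\boldsymbol\xi_{k,i}\in Z_k$ with distribution $L_k(\cdot|\theta^\circ)$, where $\theta^\circ$ is the true state of the sub-network of $k$, and the vectors $(\boldsymbol\xi_{k,i})_{k\in\mathcal N}$, $i\ge1$, are independent over time. Starting from prior probability mass functions $\mu_{k,0}$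 on $\Theta$, all agents use the self-aware diffusion update, for $i\ge1$, $$\boldsymbol\psi_{k,i}(\theta)=(1-\gamma_{k,i})\boldsymbol\mu_{k,i-1}(\theta)+\gamma_{k,i}\frac{\boldsymbol\mu_{k,i-1}(\theta)L_k(\boldsymbol\xi_{k,i}|\theta)}{\sum_{\theta'\in\Theta}\boldsymbol\mu_{k,i-1}(\theta')L_k(\boldsymbol\xi_{k,i}|\theta')},\qquad \boldsymbol\mu_{k,i}(\theta)=\sum_{\ell\in\mathcal N}a_{\ell k}\boldsymbol\psi_{\ell,i}(\theta),$$ with deterministic weights $\gamma_{k,i}\in[0,1]$ (if the denominator is $0$, the fraction is read as $\boldsymbol\mu_{k,i-1}(\theta)$). Let $s$ be a sending sub-network with true state $\theta^\circ_s$. For each agent $k$ of $s$ let $\Theta_k=\{\theta\in\Theta: L_k(\zeta|\theta)=L_k(\zeta|\theta^\circ_s)\ \forall \zeta\in Z_k\}$. Assume that 1. $\liminf_{i\to\infty}\gamma_{k,i}>0$ for each agent $k$ of $s$ (for instance, $\lim_{i\to\infty}\gamma_{k,i}$ exists and is not $0$); 2. $\mu_{k,0}(\theta^\circ_s)>0$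 for at least one agent $k$ of $s$; 3. each agent $k$ of $s$ has a prevailing signal, that is, some $\zeta_k^\circ\in Z_k$ with $L_k(\zeta_k^\circ|\theta^\circ_s)>L_k(\zeta_k^\circ|\theta)$ for all $\theta\in\Theta\setminus\Theta_k$; 4. $\theta^\circ_s$ is globally identifiable in $s$: $\bigcap_{k\in s}\Theta_k=\{\theta^\circ_s\}$. Then every agent $k$ of $s$ learns the truth: $\lim_{i\to\infty}\boldsymbol\mu_{k,i}(\theta^\circ_s)=1$ almost surely. -/

import Mathlib

open MeasureTheory ProbabilityTheory Filter Topology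

/-- There is a directed path from `k` to `ℓ`, along links of positive
weight, all of whose agents belong to the set `C`. The entry `a ℓ k` is the weight that agent `k`
gives to the data arriving from agent `ℓ`. -/
def PathWithin {N : Type*} (a : Matrix N N ℝ) (C : Set N) (k ℓ : N) : Prop :=
  Relation.ReflTransGen (fun i j => i ∈ C ∧ j ∈ C ∧ 0 < a i j) k ℓ

/-- A weakly-connected network on the finite set of agents `N`, with `S` sending and `R` receiving
sub-networks. The combination matrix is left-stochastic; with the agents listed sub-network by
sub-network it has the block upper-triangular form of a weak graph. `R = 0`, `S = 1` is a single
strongly-connected network. -/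
structure WeakNetwork (N : Type*) [Fintype N] (S R : ℕ) where
  /-- combination weights: `a ℓ k` is the weight with which `k` scales data arriving from `ℓ` -/
  a : Matrix N N ℝ
  /-- the sub-network of each agent: `Sum.inl s` is sending, `Sum.inr r` is receiving -/
  sub : N → Fin S ⊕ Fin R
  nonneg : ∀ ℓ k, 0 ≤ a ℓ k
  sum_eq_one : ∀ k, ∑ ℓ, a ℓ k = 1
  /-- a sending sub-network gets no data from outside -/
  sending_closed : ∀ s ℓ k, sub k = Sum.inl s → sub ℓ ≠ Sum.inl s → a ℓ k = 0
  /-- each sending sub-network is strongly connected: a path joins any two agents ... -/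
  sending_path : ∀ s k ℓ, sub k = Sum.inl s → sub ℓ = Sum.inl s →
    PathWithin a {j | sub j = Sum.inl s} k ℓ
  /-- ... and at least one agent has a self-loop -/
  sending_loop : ∀ s, ∃ k, sub k = Sum.inl s ∧ 0 < a k k
  /-- each receiving sub-network is connected -/
  receiving_path : ∀ r k ℓ, sub k = Sum.inr r → sub ℓ = Sum.inr r →
    PathWithin a {j | sub j = Sum.inr r} k ℓ
  /-- a receiving sub-network gets no data from later receiving sub-networks -/
  receiving_triangular : ∀ r r' ℓ k, sub ℓ = Sum.inr r' → sub k = Sum.inr r → r < r' → a ℓ k = 0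

/-- `p` is a probability mass function on the finite type `X`. -/
def IsMassFunction {X : Type*} [Fintype X] (p : X → ℝ) : Prop :=
  (∀ x, 0 ≤ p x) ∧ ∑ x, p x = 1

/-- The forecast `∑ θ, μ θ * L (ζ | θ)` of the signal `ζ`, where `L θ ζ` is the likelihood
of `ζ` under the state `θ` and `μ` is the current belief. -/
def forecast {Θ Z : Type*} [Fintype Θ] (L : Θ → Z → ℝ) (μ : Θ → ℝ) (ζ : Z) : ℝ :=
  ∑ θ, μ θ * L θ ζ

open Classical in
/-- The Bayesian update of the belief `μ` after the signal `ζ`. If the forecast of `ζ` is zero,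
Bayes' rule has no meaning (`0 / 0`); the belief, which has to stay a probability mass function,
is then kept. -/
noncomputable def bayesUpdate {Θ Z : Type*} [Fintype Θ] (L : Θ → Z → ℝ) (μ : Θ → ℝ) (ζ : Z)
    (θ : Θ) : ℝ :=
  if forecast L μ ζ = 0 then μ θ else μ θ * L θ ζ / forecast L μ ζ

/-- The intermediate belief of a self-aware agent: a convex combination, with weight `γ` on the
Bayesian update, of its previous belief and the Bayesian update. -/
noncomputable def selfAwareUpdate {Θ Z : Type*} [Fintype Θ] (γ : ℝ) (L : Θ → Z → ℝ) (μ : Θ → ℝ)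
    (ζ : Z) (θ : Θ) : ℝ :=
  (1 - γ) * μ θ + γ * bayesUpdate L μ ζ θ

/-- The beliefs `belief … i k θ` of all agents `k` at time `i`, under self-aware diffusion learning
with combination matrix `a`, weights `γ k i`, likelihoods `L k θ ζ`, priors `μ₀ k θ` and observed
signals `x k i` (the weights and signals are used for `i ≥ 1` only). -/
noncomputable def belief {N Θ : Type*} [Fintype N] [Fintype Θ] {Z : N → Type*}
    (a : Matrix N N ℝ) (γ : N → ℕ → ℝ) (L : ∀ k, Θ → Z k → ℝ) (μ₀ : N → Θ → ℝ)
    (x : ∀ k, ℕ → Z k) : ℕ → N → Θ → ℝ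
  | 0 => μ₀
  | i + 1 => fun k θ =>
      ∑ ℓ, a ℓ k * selfAwareUpdate (γ ℓ (i + 1)) (L ℓ) (belief a γ L μ₀ x i ℓ) (x ℓ (i + 1)) θ

/-- The set of states that an agent with likelihood `L` cannot distinguish from the state `θ₀`. -/
def indistinguishable {Θ Z : Type*} (L : Θ → Z → ℝ) (θ₀ : Θ) : Set Θ :=
  {θ | ∀ ζ, L θ ζ = L θ₀ ζ}

/-- `ζ` is a prevailing signal, when the true state is `θ₀`: it is more likely under `θ₀` than under
every state that can be distinguished from `θ₀`. -/
def IsPrevailing {Θ Z : Type*} (L : Θ → Z → ℝ) (θ₀ : Θ) (ζ : Z) : Prop :=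
  ∀ θ, θ ∉ indistinguishable L θ₀ → L θ ζ < L θ₀ ζ

/-- The random signals `ξ k i`, `i ≥ 1`: agent `k`'s signals are distributed according to the mass
function `p k`, and the signals of the network are independent over time. Nothing is assumed on the
dependence, at one and the same time, between the signals of different agents. -/
structure IsSignalProcess {N Ω : Type*} {Z : N → Type*} [∀ k, MeasurableSpace (Z k)]
    [MeasurableSpace Ω] (P : Measure Ω) (p : ∀ k, Z k → ℝ) (ξ : ∀ k, ℕ → Ω → Z k) : Prop where
  measurable : ∀ k i, 1 ≤ i → Measurable (ξ k i)
  law : ∀ k i, 1 ≤ i → ∀ ζ, P {ω | ξ k i ω = ζ} = ENNReal.ofReal (p k ζ)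
  indep : iIndepFun (fun (i : ℕ) (ω : Ω) (k : N) => ξ k (i + 1) ω) P

/-! A sending sub-network receives no outside data, so its weights have a stationary (Perron) vector
`y`, positive on the sub-network and zero elsewhere (`exists_stationary_pos`). The argument follows
`e i`, the expectation of the `y`-weighted sum of the log-beliefs in the true state. Combining
neighbours' beliefs does not lower this sum, by Jensen and stationarity
(`sum_mul_log_belief_add_le`). A fresh signal is independent of the past, so concavity of the
logarithm makes the expected gain of an agent at least `γ` times the relative entropy of the true
signal law with respect to the agent's forecast (`le_sum_mul_log_selfAware_factor`).

As `e i ≤ 0`, the expected gains are summable. Relative entropy dominates the squared forecast error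
at any one signal, so this error tends to zero almost surely. At a prevailing signal it dominates a
multiple of the belief in each distinguishable state, so the agent rejects these states
(`ae_tendsto_belief_zero`).

An agent that cannot distinguish a state passes a fixed fraction of its belief in it to its
neighbours; if theirs vanishes, so does its own. Paths and global identifiability then eliminate
every false state (`tendsto_belief_zero_of_path`). -/

/-! ### Mass functions and the one-agent update -/

section MassFunction

variable {Θ Z : Type*} [Fintype Θ] [Fintype Z]

theorem IsMassFunction.le_one {p : Z → ℝ} (hp : IsMassFunction p) (z : Z) : p z ≤ 1 := by
  rw [← hp.2]
  exact Finset.single_le_sum (fun i _ => hp.1 i) (Finset.mem_univ z)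

theorem isMassFunction_forecast {L : Θ → Z → ℝ} (hL : ∀ θ, IsMassFunction (L θ)) {μ : Θ → ℝ}
    (hμ : IsMassFunction μ) : IsMassFunction (forecast L μ) := by
  refine ⟨fun z => Finset.sum_nonneg fun θ _ => mul_nonneg (hμ.1 θ) ((hL θ).1 z), ?_⟩
  unfold forecast
  rw [Finset.sum_comm]
  simp only [← Finset.mul_sum, (hL _).2, mul_one, hμ.2]

theorem mul_le_forecast {L : Θ → Z → ℝ} (hL : ∀ θ, IsMassFunction (L θ)) {μ : Θ → ℝ}
    (hμ : IsMassFunction μ) (z : Z) (θ : Θ) : μ θ * L θ z ≤ forecast L μ z :=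
  Finset.single_le_sum (f := fun θ => μ θ * L θ z)
    (fun θ _ => mul_nonneg (hμ.1 θ) ((hL θ).1 z)) (Finset.mem_univ θ)

theorem isMassFunction_bayesUpdate {L : Θ → Z → ℝ} (hL : ∀ θ, IsMassFunction (L θ)) {μ : Θ → ℝ}
    (hμ : IsMassFunction μ) (z : Z) : IsMassFunction (bayesUpdate L μ z) := by
  by_cases h : forecast L μ z = 0
  · have : bayesUpdate L μ z = μ := by
      funext θ
      simp [bayesUpdate, h]
    rwa [this]
  · have : bayesUpdate L μ z = fun θ => μ θ * L θ z / forecast L μ z := by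
      funext θ
      simp [bayesUpdate, h]
    rw [this]
    refine ⟨fun θ => div_nonneg (mul_nonneg (hμ.1 θ) ((hL θ).1 z))
      ((isMassFunction_forecast hL hμ).1 z), ?_⟩
    rw [← Finset.sum_div]
    exact div_self h

theorem isMassFunction_selfAwareUpdate {L : Θ → Z → ℝ} (hL : ∀ θ, IsMassFunction (L θ))
    {μ : Θ → ℝ} (hμ : IsMassFunction μ) {γ : ℝ} (hγ : γ ∈ Set.Icc (0 : ℝ) 1) (z : Z) :
    IsMassFunction (selfAwareUpdate γ L μ z) := by
  have hb := isMassFunction_bayesUpdate hL hμ z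
  refine ⟨fun θ => add_nonneg (mul_nonneg (by linarith [hγ.2]) (hμ.1 θ))
    (mul_nonneg hγ.1 (hb.1 θ)), ?_⟩
  simp only [selfAwareUpdate, Finset.sum_add_distrib, ← Finset.mul_sum, hμ.2, hb.2]
  ring

/-- A forecast is at most 1, so dividing by it only helps; `c ≤ 1` covers the kept part of the
belief and the case of zero forecast. -/
theorem mul_le_selfAwareUpdate {L : Θ → Z → ℝ} (hL : ∀ θ, IsMassFunction (L θ)) {μ : Θ → ℝ}
    (hμ : IsMassFunction μ) {γ : ℝ} (hγ : γ ∈ Set.Icc (0 : ℝ) 1) {z : Z} {θ : Θ} {c : ℝ}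
    (hc : c ≤ 1) (hcL : c ≤ L θ z) : c * μ θ ≤ selfAwareUpdate γ L μ z θ := by
  have hμθ := hμ.1 θ
  have h1 : c * μ θ ≤ μ θ := by nlinarith
  have h2 : c * μ θ ≤ bayesUpdate L μ z θ := by
    unfold bayesUpdate
    split_ifs with h
    · exact h1
    · have hm := isMassFunction_forecast hL hμ
      have hpos : 0 < forecast L μ z := lt_of_le_of_ne (hm.1 z) (Ne.symm h)
      calc c * μ θ ≤ μ θ * L θ z := by nlinarith
        _ ≤ μ θ * L θ z / forecast L μ z :=
          le_div_self (mul_nonneg hμθ ((hL θ).1 z)) hpos (hm.le_one z)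
  unfold selfAwareUpdate
  nlinarith [hγ.1, hγ.2, mul_le_mul_of_nonneg_left h2 hγ.1,
    mul_le_mul_of_nonneg_left h1 (sub_nonneg.2 hγ.2)]

end MassFunction

theorem selfAwareUpdate_eq_mul {Θ Z : Type*} [Fintype Θ] {L : Θ → Z → ℝ} {μ : Θ → ℝ} {γ : ℝ} {z : Z} {θ : Θ}
    (h : forecast L μ z ≠ 0) :
    selfAwareUpdate γ L μ z θ = μ θ * (1 - γ + γ * (L θ z / forecast L μ z)) := by
  simp only [selfAwareUpdate, bayesUpdate, h, if_false]
  ring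

/-! ### Concavity of the logarithm and relative entropy -/

section Entropy

theorem mul_log_le_log_one_sub_add {γ r : ℝ} (hγ : γ ∈ Set.Icc (0 : ℝ) 1) (hr : 0 < r) :
    γ * Real.log r ≤ Real.log (1 - γ + γ * r) := by
  have h := strictConcaveOn_log_Ioi.concaveOn.2 (Set.mem_Ioi.2 one_pos) (Set.mem_Ioi.2 hr)
    (sub_nonneg.2 hγ.2) hγ.1 (sub_add_cancel 1 γ)
  simpa using h

/-- Jensen's inequality, with positivity asked only where the weight is positive, since agents
outside the class may have zero belief. -/
theorem sum_mul_log_le_log_sum {ι : Type*} [Fintype ι] {w f : ι → ℝ} (hw : IsMassFunction w)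
    (hf : ∀ i, 0 < w i → 0 < f i) :
    ∑ i, w i * Real.log (f i) ≤ Real.log (∑ i, w i * f i) := by
  classical
  -- Off the support of `w` the point is replaced by 1, which lies in the domain of concavity and
  -- does not change the sums.
  have h := strictConcaveOn_log_Ioi.concaveOn.le_map_sum (t := Finset.univ) (w := w)
    (p := fun i => if 0 < w i then f i else 1) (fun i _ => hw.1 i) hw.2
    (fun i _ => by
      by_cases h : 0 < w i
      · simpa [h] using hf i h
      · simp [h])
  have key : ∀ g : ℝ → ℝ, ∀ i, w i * g (if 0 < w i then f i else 1) = w i * g (f i) := by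
    intro g i
    rcases (hw.1 i).eq_or_lt with h | h
    · simp [← h]
    · simp [h]
  simp only [smul_eq_mul] at h
  rwa [Finset.sum_congr rfl fun i _ => key Real.log i,
    Finset.sum_congr rfl fun i _ => key (fun r => r) i] at h

/-- The relative entropy of two mass functions dominates the squared Hellinger distance, hence the
squared difference of their values at any point. -/
theorem sq_sub_div_four_le_sum_mul_log {Z : Type*} [Fintype Z] {p q : Z → ℝ}
    (hp : IsMassFunction p) (hq : IsMassFunction q) (hpq : ∀ z, 0 < p z → 0 < q z) (z₀ : Z) :
    (p z₀ - q z₀) ^ 2 / 4 ≤ ∑ z, p z * Real.log (p z / q z) := by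
  have hterm : ∀ z, 2 * p z - 2 * (√(p z) * √(q z)) ≤ p z * Real.log (p z / q z) := by
    intro z
    rcases (hp.1 z).eq_or_lt with h | h
    · simp [← h]
    · have hqz := hpq z h
      -- `log t ≤ t - 1` at `t = √(q/p)` gives the Hellinger affinity term.
      have hl := Real.log_le_sub_one_of_pos (Real.sqrt_pos.2 (div_pos hqz h))
      rw [Real.log_sqrt (div_pos hqz h).le, Real.log_div hqz.ne' h.ne',
        Real.sqrt_div hqz.le] at hl
      rw [Real.log_div h.ne' hqz.ne']
      have hs : p z * (√(q z) / √(p z)) = √(p z) * √(q z) := by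
        have := Real.sqrt_pos.2 h
        field_simp
        rw [Real.sq_sqrt h.le]
      nlinarith [mul_le_mul_of_nonneg_left hl h.le]
  have hsum : ∑ z, (√(p z) - √(q z)) ^ 2 = ∑ z, (2 * p z - 2 * (√(p z) * √(q z))) := by
    have : ∀ z, (√(p z) - √(q z)) ^ 2
        = 2 * p z - 2 * (√(p z) * √(q z)) + (q z - p z) := by
      intro z
      rw [sub_sq, Real.sq_sqrt (hp.1 z), Real.sq_sqrt (hq.1 z)]
      ring
    simp only [this]
    rw [Finset.sum_add_distrib, Finset.sum_sub_distrib (fun z => q z) (fun z => p z), hp.2, hq.2]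
    ring
  have hsingle : (√(p z₀) - √(q z₀)) ^ 2 ≤ ∑ z, (√(p z) - √(q z)) ^ 2 :=
    Finset.single_le_sum (f := fun z => (√(p z) - √(q z)) ^ 2)
      (fun _ _ => sq_nonneg _) (Finset.mem_univ z₀)
  -- The 4 is the bound on `(√p + √q) ^ 2`, both roots being at most 1.
  have hdiff : (p z₀ - q z₀) ^ 2 / 4 ≤ (√(p z₀) - √(q z₀)) ^ 2 := by
    have e : p z₀ - q z₀ = (√(p z₀) - √(q z₀)) * (√(p z₀) + √(q z₀)) := by
      nlinarith [Real.sq_sqrt (hp.1 z₀), Real.sq_sqrt (hq.1 z₀)]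
    have h1 : √(p z₀) ≤ 1 := Real.sqrt_le_one.2 (hp.le_one z₀)
    have h2 : √(q z₀) ≤ 1 := Real.sqrt_le_one.2 (hq.le_one z₀)
    have h3 : (√(p z₀) + √(q z₀)) ^ 2 ≤ 4 := by
      nlinarith [Real.sqrt_nonneg (p z₀), Real.sqrt_nonneg (q z₀)]
    rw [e, mul_pow]
    nlinarith [mul_le_mul_of_nonneg_left h3 (sq_nonneg (√(p z₀) - √(q z₀)))]
  calc _ ≤ _ := hdiff
    _ ≤ _ := hsingle
    _ = _ := hsum
    _ ≤ _ := Finset.sum_le_sum fun z _ => hterm z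

theorem le_sum_mul_log_selfAware_factor {Θ Z : Type*} [Fintype Θ] [Fintype Z] {L : Θ → Z → ℝ}
    (hL : ∀ θ, IsMassFunction (L θ)) {μ : Θ → ℝ} (hμ : IsMassFunction μ) {γ : ℝ}
    (hγ : γ ∈ Set.Icc (0 : ℝ) 1) {θ₀ : Θ} (h₀ : 0 < μ θ₀) (z₀ : Z) :
    γ * ((L θ₀ z₀ - forecast L μ z₀) ^ 2 / 4) ≤
      ∑ z, L θ₀ z * Real.log (1 - γ + γ * (L θ₀ z / forecast L μ z)) := by
  have hpos : ∀ z, 0 < L θ₀ z → 0 < forecast L μ z := fun z hz =>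
    (mul_pos h₀ hz).trans_le (mul_le_forecast hL hμ z θ₀)
  refine (mul_le_mul_of_nonneg_left (sq_sub_div_four_le_sum_mul_log (hL θ₀)
    (isMassFunction_forecast hL hμ) hpos z₀) hγ.1).trans ?_
  rw [Finset.mul_sum]
  refine Finset.sum_le_sum fun z _ => ?_
  rcases ((hL θ₀).1 z).eq_or_lt with h | h
  · simp [← h]
  · rw [mul_left_comm]
    exact mul_le_mul_of_nonneg_left
      (mul_log_le_log_one_sub_add hγ (div_pos h (hpos z h))) h.le

/-- The forecast error at a prevailing signal is a belief-average of nonnegative likelihood gaps, so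
it dominates each single term. -/
theorem IsPrevailing.mul_le_sub_forecast {Θ Z : Type*} [Fintype Θ] {L : Θ → Z → ℝ} {μ : Θ → ℝ}
    (hμ : IsMassFunction μ) {θ₀ : Θ} {z₀ : Z} (h : IsPrevailing L θ₀ z₀) (θ : Θ) :
    μ θ * (L θ₀ z₀ - L θ z₀) ≤ L θ₀ z₀ - forecast L μ z₀ := by
  have hle : ∀ θ', 0 ≤ L θ₀ z₀ - L θ' z₀ := by
    intro θ'
    by_cases hθ' : θ' ∈ indistinguishable L θ₀
    · rw [hθ' z₀, sub_self]
    · exact sub_nonneg.2 (h θ' hθ').le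
  have e : L θ₀ z₀ - forecast L μ z₀ = ∑ θ', μ θ' * (L θ₀ z₀ - L θ' z₀) := by
    simp only [mul_sub, Finset.sum_sub_distrib, ← Finset.sum_mul, hμ.2, one_mul, forecast]
  rw [e]
  exact Finset.single_le_sum (f := fun θ' => μ θ' * (L θ₀ z₀ - L θ' z₀))
    (fun θ' _ => mul_nonneg (hμ.1 θ') (hle θ')) (Finset.mem_univ θ)

end Entropy

/-! ### The Perron vector of a closed irreducible class -/

section Stationary

/-- The Perron vector of a closed, irreducible class `C` of a left-stochastic matrix. -/
theorem exists_stationary_pos {N : Type*} [Fintype N] {a : Matrix N N ℝ} {C : Set N}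
    (hne : C.Nonempty) (h0 : ∀ ℓ k, 0 ≤ a ℓ k) (h1 : ∀ k, ∑ ℓ, a ℓ k = 1)
    (hclosed : ∀ ℓ k, k ∈ C → ℓ ∉ C → a ℓ k = 0)
    (hpath : ∀ k ∈ C, ∀ ℓ ∈ C, PathWithin a C k ℓ) :
    ∃ y : N → ℝ, (∀ k ∈ C, 0 < y k) ∧ (∀ k, k ∉ C → y k = 0) ∧
      ∀ ℓ, ∑ k, a ℓ k * y k = y ℓ := by
  classical
  set B : Matrix N N ℝ := fun ℓ k => if k ∈ C then a ℓ k else 0 with hB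
  have hB0 : ∀ ℓ k, 0 ≤ B ℓ k := by
    intro ℓ k
    simp only [hB]
    split_ifs
    exacts [h0 ℓ k, le_rfl]
  have hdet : (B - 1).det = 0 := by
    rw [← Matrix.exists_vecMul_eq_zero_iff]
    -- Closedness of `C` makes its indicator a left eigenvector of `B` for the eigenvalue 1.
    refine ⟨fun k => if k ∈ C then 1 else 0, ?_, ?_⟩
    · obtain ⟨k, hk⟩ := hne
      intro h
      simpa [hk] using congrFun h k
    · rw [Matrix.vecMul_sub, Matrix.vecMul_one, sub_eq_zero]
      funext k
      simp only [Matrix.vecMul, dotProduct, hB]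
      split_ifs with hk
      · refine Eq.trans ?_ (h1 k)
        refine Finset.sum_congr rfl fun ℓ _ => ?_
        by_cases hℓ : ℓ ∈ C
        · simp [hℓ]
        · simp [hℓ, hclosed ℓ k hk hℓ]
      · simp
  obtain ⟨v, hv0, hv⟩ := Matrix.exists_mulVec_eq_zero_iff.2 hdet
  rw [Matrix.sub_mulVec, Matrix.one_mulVec, sub_eq_zero] at hv
  have hv' : ∀ ℓ, ∑ k, B ℓ k * v k = v ℓ := fun ℓ => congrFun hv ℓ
  have hle : ∀ ℓ, |v ℓ| ≤ ∑ k, B ℓ k * |v k| := by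
    intro ℓ
    calc |v ℓ| = |∑ k, B ℓ k * v k| := by rw [hv' ℓ]
      _ ≤ ∑ k, |B ℓ k * v k| := Finset.abs_sum_le_sum_abs _ _
      _ = _ := Finset.sum_congr rfl fun k _ => by rw [abs_mul, abs_of_nonneg (hB0 ℓ k)]
  have hout : ∀ k, k ∉ C → v k = 0 := by
    intro ℓ hℓ
    rw [← hv' ℓ]
    refine Finset.sum_eq_zero fun k _ => ?_
    by_cases hk : k ∈ C
    · simp [hB, hclosed ℓ k hk hℓ]
    · simp [hB, hk]
  have hBa : ∀ ℓ k, B ℓ k * |v k| = a ℓ k * |v k| := by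
    intro ℓ k
    by_cases hk : k ∈ C
    · simp [hB, hk]
    · simp [hout k hk]
  -- Both sides have the same total, because the columns of `a` sum to 1; hence the termwise
  -- inequalities are equalities.
  have heq : ∀ ℓ, |v ℓ| = ∑ k, a ℓ k * |v k| := by
    simp only [hBa] at hle
    have htot : ∑ ℓ, |v ℓ| = ∑ ℓ, ∑ k, a ℓ k * |v k| := by
      rw [Finset.sum_comm]
      simp only [← Finset.sum_mul, h1, one_mul]
    intro ℓ
    exact (Finset.sum_eq_sum_iff_of_le fun i _ => hle i).1 htot ℓ (Finset.mem_univ ℓ)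
  refine ⟨fun k => |v k|, ?_, fun k hk => by simp [hout k hk], fun ℓ => (heq ℓ).symm⟩
  obtain ⟨k₀, hk₀⟩ := Function.ne_iff.1 hv0
  have hk₀C : k₀ ∈ C := by
    by_contra h
    exact hk₀ (hout k₀ h)
  intro k hk
  refine Relation.ReflTransGen.head_induction_on (hpath k hk k₀ hk₀C) (abs_pos.2 hk₀) ?_
  rintro i j ⟨-, -, hij⟩ - hj
  refine lt_of_lt_of_eq ?_ (heq i).symm
  exact (mul_pos hij hj).trans_le (Finset.single_le_sum (f := fun k => a i k * |v k|)
    (fun k _ => mul_nonneg (h0 i k) (abs_nonneg _)) (Finset.mem_univ j))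

end Stationary

/-! ### Deterministic properties of the belief recursion -/

section Belief

variable {N Θ : Type*} [Fintype N] [Fintype Θ] {Z : N → Type*}

theorem isMassFunction_belief [∀ k, Fintype (Z k)] {a : Matrix N N ℝ} (h0 : ∀ ℓ k, 0 ≤ a ℓ k)
    (h1 : ∀ k, ∑ ℓ, a ℓ k = 1) {γ : N → ℕ → ℝ} (hγ : ∀ k i, 1 ≤ i → γ k i ∈ Set.Icc (0 : ℝ) 1)
    {L : ∀ k, Θ → Z k → ℝ} (hL : ∀ k θ, IsMassFunction (L k θ)) {μ₀ : N → Θ → ℝ}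
    (hμ₀ : ∀ k, IsMassFunction (μ₀ k)) (x : ∀ k, ℕ → Z k) (i : ℕ) (k : N) :
    IsMassFunction (belief a γ L μ₀ x i k) := by
  induction i generalizing k with
  | zero => exact hμ₀ k
  | succ i ih =>
    have hψ := fun ℓ => isMassFunction_selfAwareUpdate (hL ℓ) (ih ℓ) (hγ ℓ (i + 1) (by simp))
      (x ℓ (i + 1))
    refine ⟨fun θ => Finset.sum_nonneg fun ℓ _ => mul_nonneg (h0 ℓ k) ((hψ ℓ).1 θ), ?_⟩
    simp only [belief]
    rw [Finset.sum_comm]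
    simp only [← Finset.mul_sum, (hψ _).2, mul_one, h1]

theorem mul_le_belief_succ [∀ k, Fintype (Z k)] {a : Matrix N N ℝ} (h0 : ∀ ℓ k, 0 ≤ a ℓ k)
    (h1 : ∀ k, ∑ ℓ, a ℓ k = 1) {γ : N → ℕ → ℝ} (hγ : ∀ k i, 1 ≤ i → γ k i ∈ Set.Icc (0 : ℝ) 1)
    {L : ∀ k, Θ → Z k → ℝ} (hL : ∀ k θ, IsMassFunction (L k θ)) {μ₀ : N → Θ → ℝ}
    (hμ₀ : ∀ k, IsMassFunction (μ₀ k)) (x : ∀ k, ℕ → Z k) (i : ℕ) (j k : N) (θ : Θ) {c : ℝ}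
    (hc : c ≤ 1) (hcL : c ≤ L j θ (x j (i + 1))) :
    a j k * (c * belief a γ L μ₀ x i j θ) ≤ belief a γ L μ₀ x (i + 1) k θ := by
  have hm := fun ℓ => isMassFunction_belief h0 h1 hγ hL hμ₀ x i ℓ
  have hγ' := fun ℓ => hγ ℓ (i + 1) (by simp)
  refine (mul_le_mul_of_nonneg_left
    (mul_le_selfAwareUpdate (hL j) (hm j) (hγ' j) hc hcL) (h0 j k)).trans ?_
  exact Finset.single_le_sum (f := fun ℓ => a ℓ k * selfAwareUpdate (γ ℓ (i + 1)) (L ℓ)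
    (belief a γ L μ₀ x i ℓ) (x ℓ (i + 1)) θ) (fun ℓ _ => mul_nonneg (h0 ℓ k)
    ((isMassFunction_selfAwareUpdate (hL ℓ) (hm ℓ) (hγ' ℓ) _).1 θ)) (Finset.mem_univ j)

/-- In a strongly connected class with a self-loop, from some time on every agent gives the state
`θ` positive belief, whatever the signals that are possible under `θ`. -/
theorem exists_forall_belief_pos [∀ k, Fintype (Z k)] {a : Matrix N N ℝ} {C : Set N}
    (h0 : ∀ ℓ k, 0 ≤ a ℓ k)
    (h1 : ∀ k, ∑ ℓ, a ℓ k = 1) (hpath : ∀ k ∈ C, ∀ ℓ ∈ C, PathWithin a C k ℓ)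
    (hloop : ∃ k ∈ C, 0 < a k k)
    {γ : N → ℕ → ℝ} (hγ : ∀ k i, 1 ≤ i → γ k i ∈ Set.Icc (0 : ℝ) 1)
    {L : ∀ k, Θ → Z k → ℝ} (hL : ∀ k θ, IsMassFunction (L k θ)) {μ₀ : N → Θ → ℝ}
    (hμ₀ : ∀ k, IsMassFunction (μ₀ k)) {θ : Θ} (hprior : ∃ k ∈ C, 0 < μ₀ k θ) :
    ∃ T, ∀ i, T ≤ i → ∀ k ∈ C, ∀ x : ∀ k, ℕ → Z k,
      (∀ k ∈ C, ∀ i, 0 < L k θ (x k (i + 1))) → 0 < belief a γ L μ₀ x i k θ := by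
  classical
  -- Quantifying over all admissible signals inside `Pos` makes the time `T` independent of the
  -- sample point.
  let Pos : ℕ → N → Prop := fun i k => ∀ x : ∀ k, ℕ → Z k,
      (∀ k ∈ C, ∀ i, 0 < L k θ (x k (i + 1))) → 0 < belief a γ L μ₀ x i k θ
  have step : ∀ i j k, j ∈ C → 0 < a j k → Pos i j → Pos (i + 1) k := by
    intro i j k hj hjk hP x hx
    exact (mul_pos hjk (mul_pos (lt_min one_pos (hx j hj i)) (hP x hx))).trans_le
      (mul_le_belief_succ h0 h1 hγ hL hμ₀ x i j k θ (min_le_left _ _) (min_le_right _ _))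
  obtain ⟨k₀, hk₀, hpos⟩ := hprior
  obtain ⟨j₀, hj₀, hloop⟩ := hloop
  have hj₀pos : ∃ i, Pos i j₀ := by
    have hp : Relation.ReflTransGen _ k₀ j₀ := hpath k₀ hk₀ j₀ hj₀
    clear hj₀ hloop
    induction hp with
    | refl => exact ⟨0, fun _ _ => hpos⟩
    | tail _ h ih =>
      obtain ⟨hb, -, hbc⟩ := h
      obtain ⟨i, hi⟩ := ih
      exact ⟨i + 1, step i _ _ hb hbc hi⟩
  -- Once the agent with the self-loop has positive belief it keeps it forever, and the positivity
  -- spreads along paths with one step of delay per link.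
  have hall : ∀ k ∈ C, ∃ T, ∀ i, T ≤ i → Pos i k := by
    intro k hk
    have hp : Relation.ReflTransGen _ j₀ k := hpath j₀ hj₀ k hk
    clear hk
    induction hp with
    | refl =>
      obtain ⟨T, hT⟩ := hj₀pos
      refine ⟨T, fun i hi => ?_⟩
      induction i, hi using Nat.le_induction with
      | base => exact hT
      | succ i _ ih => exact step i _ _ hj₀ hloop ih
    | tail _ h ih =>
      obtain ⟨hb, -, hbc⟩ := h
      obtain ⟨T, hT⟩ := ih
      refine ⟨T + 1, fun i hi => ?_⟩
      obtain ⟨i, rfl⟩ : ∃ i', i = i' + 1 := ⟨i - 1, by omega⟩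
      exact step i _ _ hb hbc (hT i (by omega))
  choose! T hT using hall
  refine ⟨Finset.univ.sup T, fun i hi k hk => hT k hk i ?_⟩
  exact (Finset.le_sup (Finset.mem_univ k)).trans hi

/-- The growth of the weighted log-belief in one step, for a stationary weight `y`. -/
theorem sum_mul_log_belief_add_le [∀ k, Fintype (Z k)] {a : Matrix N N ℝ} {C : Set N}
    (h0 : ∀ ℓ k, 0 ≤ a ℓ k)
    (h1 : ∀ k, ∑ ℓ, a ℓ k = 1) (hclosed : ∀ ℓ k, k ∈ C → ℓ ∉ C → a ℓ k = 0)
    {y : N → ℝ} (hy : ∀ k ∈ C, 0 < y k) (hy0 : ∀ k, k ∉ C → y k = 0)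
    (hya : ∀ ℓ, ∑ k, a ℓ k * y k = y ℓ)
    {γ : N → ℕ → ℝ} (hγ : ∀ k i, 1 ≤ i → γ k i ∈ Set.Icc (0 : ℝ) 1)
    {L : ∀ k, Θ → Z k → ℝ} (hL : ∀ k θ, IsMassFunction (L k θ)) {μ₀ : N → Θ → ℝ}
    (hμ₀ : ∀ k, IsMassFunction (μ₀ k)) {θ : Θ} {x : ∀ k, ℕ → Z k} {i : ℕ}
    (hx : ∀ k ∈ C, 0 < L k θ (x k (i + 1)))
    (hpos : ∀ k ∈ C, 0 < belief a γ L μ₀ x i k θ) :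
    ∑ k, y k * Real.log (belief a γ L μ₀ x i k θ) +
      ∑ k, y k * Real.log (1 - γ k (i + 1) + γ k (i + 1) *
        (L k θ (x k (i + 1)) / forecast (L k) (belief a γ L μ₀ x i k) (x k (i + 1)))) ≤
    ∑ k, y k * Real.log (belief a γ L μ₀ x (i + 1) k θ) := by
  have hm := fun ℓ => isMassFunction_belief h0 h1 hγ hL hμ₀ x i ℓ
  have hγ' := fun ℓ => hγ ℓ (i + 1) (by simp)
  set ψ : N → ℝ := fun ℓ =>
    selfAwareUpdate (γ ℓ (i + 1)) (L ℓ) (belief a γ L μ₀ x i ℓ) (x ℓ (i + 1)) θ with hψ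
  have hψpos : ∀ ℓ ∈ C, 0 < ψ ℓ := fun ℓ hℓ =>
    (mul_pos (lt_min one_pos (hx ℓ hℓ)) (hpos ℓ hℓ)).trans_le
      (mul_le_selfAwareUpdate (hL ℓ) (hm ℓ) (hγ' ℓ) (min_le_left _ _) (min_le_right _ _))
  have hlogψ : ∑ k, y k * Real.log (belief a γ L μ₀ x i k θ) +
      ∑ k, y k * Real.log (1 - γ k (i + 1) + γ k (i + 1) *
        (L k θ (x k (i + 1)) / forecast (L k) (belief a γ L μ₀ x i k) (x k (i + 1)))) =
      ∑ ℓ, y ℓ * Real.log (ψ ℓ) := by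
    rw [← Finset.sum_add_distrib]
    refine Finset.sum_congr rfl fun ℓ _ => ?_
    by_cases hℓ : ℓ ∈ C
    · have hf : 0 < forecast (L ℓ) (belief a γ L μ₀ x i ℓ) (x ℓ (i + 1)) :=
        (mul_pos (hpos ℓ hℓ) (hx ℓ hℓ)).trans_le (mul_le_forecast (hL ℓ) (hm ℓ) _ θ)
      have e := selfAwareUpdate_eq_mul (γ := γ ℓ (i + 1)) (θ := θ) hf.ne'
      have hp := hψpos ℓ hℓ
      simp only [hψ] at hp ⊢
      rw [e] at hp ⊢
      rw [Real.log_mul (hpos ℓ hℓ).ne' (pos_of_mul_pos_right hp (hpos ℓ hℓ).le).ne', mul_add]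
    · simp [hy0 ℓ hℓ]
  rw [hlogψ]
  -- Stationarity rewrites each weight `y ℓ` as a sum over receivers `k`; Jensen then applies to
  -- each column of `a`.
  calc ∑ ℓ, y ℓ * Real.log (ψ ℓ) = ∑ k, y k * ∑ ℓ, a ℓ k * Real.log (ψ ℓ) := by
        have e : ∀ ℓ, y ℓ * Real.log (ψ ℓ) = ∑ k, y k * (a ℓ k * Real.log (ψ ℓ)) := by
          intro ℓ
          conv_lhs => rw [← hya ℓ, Finset.sum_mul]
          exact Finset.sum_congr rfl fun k _ => by ring
        simp only [e, Finset.mul_sum]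
        exact Finset.sum_comm
    _ ≤ _ := by
        refine Finset.sum_le_sum fun k _ => ?_
        by_cases hk : k ∈ C
        · refine mul_le_mul_of_nonneg_left ?_ (hy k hk).le
          refine sum_mul_log_le_log_sum ⟨fun ℓ => h0 ℓ k, h1 k⟩ fun ℓ hℓ => hψpos ℓ ?_
          by_contra hn
          exact hℓ.ne' (hclosed ℓ k hk hn)
        · simp [hy0 k hk]

theorem belief_congr {a : Matrix N N ℝ} {γ : N → ℕ → ℝ} {L : ∀ k, Θ → Z k → ℝ}
    {μ₀ : N → Θ → ℝ} {x x' : ∀ k, ℕ → Z k} {i : ℕ}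
    (h : ∀ j < i, ∀ k, x k (j + 1) = x' k (j + 1)) :
    belief a γ L μ₀ x i = belief a γ L μ₀ x' i := by
  induction i with
  | zero => rfl
  | succ i ih =>
    funext k θ
    simp only [belief, ih fun j hj => h j (by omega), h i (by omega)]

/-- Depending on finitely many finite-valued signals, the belief takes finitely many values. This
gives integrability of any function of it, and its independence from the next signal. -/
theorem exists_belief_eq (a : Matrix N N ℝ) (γ : N → ℕ → ℝ) (L : ∀ k, Θ → Z k → ℝ)
    (μ₀ : N → Θ → ℝ) (i : ℕ) :
    ∃ G : (Finset.range i → ∀ k, Z k) → N → Θ → ℝ, ∀ x : ∀ k, ℕ → Z k,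
      belief a γ L μ₀ x i = G fun j k => x k (j + 1) := by
  let hist : (∀ k, ℕ → Z k) → (Finset.range i → ∀ k, Z k) := fun x j k => x k (j + 1)
  have hf : Function.FactorsThrough (fun x => belief a γ L μ₀ x i) hist := by
    intro x x' h
    refine belief_congr fun j hj k => ?_
    exact congrFun (congrFun h ⟨j, Finset.mem_range.2 hj⟩) k
  exact ⟨Function.extend hist (fun x => belief a γ L μ₀ x i) 0,
    fun x => (hf.extend_apply 0 x).symm⟩

/-- If the belief in `θ` vanishes for the agents that can tell `θ` from the true state, then it
vanishes for all agents of a strongly connected class that has one such agent. -/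
theorem tendsto_belief_zero_of_path [∀ k, Fintype (Z k)] {a : Matrix N N ℝ} {C : Set N}
    (h0 : ∀ ℓ k, 0 ≤ a ℓ k) (h1 : ∀ k, ∑ ℓ, a ℓ k = 1)
    (hpath : ∀ k ∈ C, ∀ ℓ ∈ C, PathWithin a C k ℓ)
    {γ : N → ℕ → ℝ} (hγ : ∀ k i, 1 ≤ i → γ k i ∈ Set.Icc (0 : ℝ) 1)
    {L : ∀ k, Θ → Z k → ℝ} (hL : ∀ k θ, IsMassFunction (L k θ)) {μ₀ : N → Θ → ℝ}
    (hμ₀ : ∀ k, IsMassFunction (μ₀ k)) {θ₀ θ : Θ} {x : ∀ k, ℕ → Z k}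
    (hx : ∀ k ∈ C, ∀ i, 0 < L k θ₀ (x k (i + 1)))
    (hlim : ∀ k ∈ C, θ ∉ indistinguishable (L k) θ₀ →
      Tendsto (fun i => belief a γ L μ₀ x i k θ) atTop (𝓝 0))
    (hex : ∃ k ∈ C, θ ∉ indistinguishable (L k) θ₀) {j : N} (hj : j ∈ C) :
    Tendsto (fun i => belief a γ L μ₀ x i j θ) atTop (𝓝 0) := by
  classical
  obtain ⟨k, hk, hkθ⟩ := hex
  refine Relation.ReflTransGen.head_induction_on (hpath j hj k hk) (hlim k hk hkθ) ?_
  rintro j k ⟨hj, -, hjk⟩ - ih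
  by_cases hθ : θ ∈ indistinguishable (L j) θ₀
  swap
  · exact hlim j hj hθ
  -- `c` is the least positive likelihood under `θ₀`, capped at 1; it serves for `θ` too, as `j`
  -- cannot tell the two apart.
  obtain ⟨c, hc0, hc1, hc⟩ : ∃ c : ℝ, 0 < c ∧ c ≤ 1 ∧ ∀ z, 0 < L j θ₀ z → c ≤ L j θ₀ z := by
    have : Nonempty (Z j) := ⟨x j 0⟩
    obtain ⟨z₁, hz₁⟩ := Finite.exists_min fun z => if 0 < L j θ₀ z then L j θ₀ z else 1
    refine ⟨min 1 (if 0 < L j θ₀ z₁ then L j θ₀ z₁ else 1), lt_min one_pos ?_,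
      min_le_left _ _, fun z hz => (min_le_right _ _).trans ((hz₁ z).trans ?_)⟩
    · split_ifs with h
      exacts [h, one_pos]
    · simp [hz]
  have hb : ∀ i, belief a γ L μ₀ x i j θ ≤
      (a j k * c)⁻¹ * belief a γ L μ₀ x (i + 1) k θ := by
    intro i
    rw [inv_mul_eq_div, le_div_iff₀ (mul_pos hjk hc0)]
    refine le_trans (le_of_eq (by ring)) (mul_le_belief_succ h0 h1 hγ hL hμ₀ x i j k θ hc1 ?_)
    rw [hθ]
    exact hc _ (hx j hj i)
  refine squeeze_zero (fun i => (isMassFunction_belief h0 h1 hγ hL hμ₀ x i j).1 θ) hb ?_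
  simpa using ((tendsto_add_atTop_iff_nat 1).2 ih).const_mul (a j k * c)⁻¹

end Belief

/-! ### Integration against independent signals; summable expectations -/

section Probability

variable {Ω : Type*} [MeasurableSpace Ω] {P : Measure Ω}

theorem integrable_comp_of_finite [IsFiniteMeasure P] {A : Type*} [MeasurableSpace A] [Finite A]
    [MeasurableSingletonClass A] {X : Ω → A} (hX : Measurable X) (f : A → ℝ) :
    Integrable (fun ω => f (X ω)) P :=
  (Integrable.of_finite (μ := P.map X) (f := f)).comp_measurable hX

/-- Averaging over `Y` with `X` frozen; used with the past as `X` and the next signal as `Y`, in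
place of a conditional expectation. -/
theorem integral_comp_indepFun [IsProbabilityMeasure P] {A B : Type*} [MeasurableSpace A]
    [Finite A] [MeasurableSingletonClass A] [MeasurableSpace B] [Fintype B]
    [MeasurableSingletonClass B] {X : Ω → A} {Y : Ω → B} (hX : Measurable X) (hY : Measurable Y)
    (h : IndepFun X Y P) (F : A → B → ℝ) :
    ∫ ω, F (X ω) (Y ω) ∂P = ∫ ω, ∑ b, P.real {ω | Y ω = b} * F (X ω) b ∂P := by
  classical
  have e : ∀ ω, F (X ω) (Y ω) = ∑ b, F (X ω) b * (if Y ω = b then 1 else 0) := by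
    intro ω
    simp
  simp_rw [e]
  rw [integral_finsetSum, integral_finsetSum]
  · refine Finset.sum_congr rfl fun b _ => ?_
    have hi : IndepFun (fun ω => F (X ω) b) (fun ω => if Y ω = b then (1 : ℝ) else 0) P :=
      h.comp (φ := fun x => F x b) (ψ := fun y => if y = b then (1 : ℝ) else 0)
        (measurable_of_finite _) (measurable_of_finite _)
    have hm := hi.integral_fun_mul_eq_mul_integral
      (integrable_comp_of_finite hX fun x => F x b).aestronglyMeasurable
      (integrable_comp_of_finite hY fun y => if y = b then (1 : ℝ) else 0).aestronglyMeasurable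
    rw [hm, integral_const_mul, mul_comm]
    congr 1
    have : (fun ω => if Y ω = b then (1 : ℝ) else 0) = Set.indicator {ω | Y ω = b} 1 := by
      funext ω
      simp [Set.indicator]
    rw [this, integral_indicator_one]
    exact hY (measurableSet_singleton b)
  · exact fun b _ => (integrable_comp_of_finite hX fun x => F x b).const_mul _
  · intro b _
    exact integrable_comp_of_finite (hX.prodMk hY)
      fun z : A × B => F z.1 b * (if z.2 = b then 1 else 0)

/-- Telescoping bounds the sum of the expectations, so the random series is almost surely finite and
its terms vanish. -/
theorem ae_tendsto_zero_of_integral_le_sub {f : ℕ → Ω → ℝ} (hf : ∀ i, Integrable (f i) P)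
    (hf0 : ∀ i ω, 0 ≤ f i ω) {e : ℕ → ℝ} {T : ℕ} {B : ℝ} (he : ∀ i, e i ≤ B)
    (h : ∀ i, T ≤ i → ∫ ω, f i ω ∂P ≤ e (i + 1) - e i) :
    ∀ᵐ ω ∂P, Tendsto (fun i => f i ω) atTop (𝓝 0) := by
  have hsum : ∀ n, ∑ i ∈ Finset.range n, ∫ ω, f (i + T) ω ∂P ≤ B - e T := by
    intro n
    calc _ ≤ ∑ i ∈ Finset.range n, (e (i + 1 + T) - e (i + T)) :=
          Finset.sum_le_sum fun i _ => by
            rw [add_right_comm]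
            exact h (i + T) (by omega)
      _ = e (n + T) - e T := by
          rw [Finset.sum_range_sub (fun i => e (i + T)), zero_add]
      _ ≤ _ := by linarith [he (n + T)]
  have hs : Summable fun i => ∫ ω, f (i + T) ω ∂P :=
    summable_of_sum_range_le (fun i => integral_nonneg (hf0 _)) hsum
  have hlin : ∫⁻ ω, ∑' i, ENNReal.ofReal (f (i + T) ω) ∂P ≠ ⊤ := by
    rw [lintegral_tsum fun i => (hf _).aestronglyMeasurable.aemeasurable.ennreal_ofReal]
    simp_rw [← fun i => ofReal_integral_eq_lintegral_ofReal (hf (i + T))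
      (Eventually.of_forall (hf0 _))]
    exact hs.tsum_ofReal_ne_top
  have hae := ae_lt_top' (AEMeasurable.tsum fun i =>
    (hf (i + T)).aestronglyMeasurable.aemeasurable.ennreal_ofReal) hlin
  filter_upwards [hae] with ω hω
  have ht := ENNReal.tendsto_atTop_zero_of_tsum_ne_top hω.ne
  have ht' := (ENNReal.tendsto_toReal ENNReal.zero_ne_top).comp ht
  refine (tendsto_add_atTop_iff_nat T).1 ?_
  simpa [Function.comp_def, ENNReal.toReal_ofReal (hf0 _ _)] using ht'

end Probability

/-! ### Signal histories and impossible signals -/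

section Signals

variable {N Ω : Type*} {Z : N → Type*} [∀ k, MeasurableSpace (Z k)] [MeasurableSpace Ω]
  {P : Measure Ω} {p : ∀ k, Z k → ℝ} {ξ : ∀ k, ℕ → Ω → Z k}

theorem IsSignalProcess.measurable_history (hξ : IsSignalProcess P p ξ) (i : ℕ) :
    Measurable fun ω (j : Finset.range i) k => ξ k (j + 1) ω :=
  measurable_pi_lambda _ fun j => measurable_pi_lambda _ fun k => hξ.measurable k _ (by simp)

theorem IsSignalProcess.indepFun_history (hξ : IsSignalProcess P p ξ) (i : ℕ) (k : N) :
    IndepFun (fun ω (j : Finset.range i) k => ξ k (j + 1) ω) (ξ k (i + 1)) P := by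
  have h := hξ.indep.indepFun_finset (Finset.range i) {i} (by simp)
    (fun j => measurable_pi_lambda _ fun k => hξ.measurable k _ (by simp))
  exact h.comp (φ := id) (ψ := fun g => g ⟨i, Finset.mem_singleton_self i⟩ k) measurable_id
    ((measurable_pi_apply k).comp (measurable_pi_apply _))

theorem IsSignalProcess.ae_pos [∀ k, Fintype (Z k)] (hξ : IsSignalProcess P p ξ) (k : N) :
    ∀ᵐ ω ∂P, ∀ i, 0 < p k (ξ k (i + 1) ω) := by
  rw [ae_all_iff]
  intro i
  have h : ∀ᵐ ω ∂P, ∀ z, p k z ≤ 0 → ξ k (i + 1) ω ≠ z := by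
    rw [ae_all_iff]
    intro z
    by_cases hz : p k z ≤ 0
    · have := hξ.law k (i + 1) (by simp) z
      rw [ENNReal.ofReal_eq_zero.2 hz] at this
      filter_upwards [measure_eq_zero_iff_ae_notMem.1 this] with ω hω _ using hω
    · exact Eventually.of_forall fun ω h => absurd h hz
  filter_upwards [h] with ω hω
  by_contra hn
  exact hω _ (not_lt.1 hn) rfl

end Signals

/-! ### Almost sure learning -/

/-- In a sending sub-network each agent asymptotically rejects the states that it can distinguish
from the true one. -/
theorem ae_tendsto_belief_zero {N Θ Ω : Type*} [Fintype N] [Fintype Θ] {Z : N → Type*}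
    [∀ k, Fintype (Z k)] [∀ k, MeasurableSpace (Z k)] [∀ k, DiscreteMeasurableSpace (Z k)]
    [MeasurableSpace Ω] {P : Measure Ω} [IsProbabilityMeasure P] {a : Matrix N N ℝ} {C : Set N}
    (h0 : ∀ ℓ k, 0 ≤ a ℓ k) (h1 : ∀ k, ∑ ℓ, a ℓ k = 1)
    (hclosed : ∀ ℓ k, k ∈ C → ℓ ∉ C → a ℓ k = 0)
    (hpath : ∀ k ∈ C, ∀ ℓ ∈ C, PathWithin a C k ℓ) (hloop : ∃ k ∈ C, 0 < a k k)
    {L : ∀ k, Θ → Z k → ℝ} (hL : ∀ k θ, IsMassFunction (L k θ)) {p : ∀ k, Z k → ℝ}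
    {ξ : ∀ k, ℕ → Ω → Z k} (hξ : IsSignalProcess P p ξ) {θ₀ : Θ}
    (hp : ∀ k ∈ C, p k = L k θ₀)
    {γ : N → ℕ → ℝ} (hγ : ∀ k i, 1 ≤ i → γ k i ∈ Set.Icc (0 : ℝ) 1)
    {μ₀ : N → Θ → ℝ} (hμ₀ : ∀ k, IsMassFunction (μ₀ k)) (hprior : ∃ k ∈ C, 0 < μ₀ k θ₀)
    {k : N} (hk : k ∈ C) (hγk : ∃ c : ℝ, 0 < c ∧ ∀ᶠ i in atTop, c ≤ γ k i)
    {z : Z k} (hz : IsPrevailing (L k) θ₀ z) {θ : Θ} (hθ : θ ∉ indistinguishable (L k) θ₀) :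
    ∀ᵐ ω ∂P, Tendsto (fun i => belief a γ L μ₀ (fun ℓ j => ξ ℓ j ω) i k θ) atTop (𝓝 0) := by
  obtain ⟨y, hy, hy0, hya⟩ := exists_stationary_pos ⟨k, hk⟩ h0 h1 hclosed hpath
  obtain ⟨T₁, hT₁⟩ := exists_forall_belief_pos h0 h1 hpath hloop hγ hL hμ₀ hprior
  obtain ⟨c, hc, hγc⟩ := hγk
  obtain ⟨T₂, hT₂⟩ := eventually_atTop.1 hγc
  have hgood : ∀ᵐ ω ∂P, ∀ k ∈ C, ∀ i, 0 < L k θ₀ (ξ k (i + 1) ω) := by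
    filter_upwards [ae_all_iff.2 fun k => hξ.ae_pos k] with ω hω k hk i
    simpa [hp k hk] using hω k i
  have hyn : ∀ k, 0 ≤ y k := fun k => by
    by_cases h : k ∈ C
    exacts [(hy k h).le, (hy0 k h).ge]
  set b : ℕ → Ω → N → Θ → ℝ := fun i ω => belief a γ L μ₀ (fun ℓ j => ξ ℓ j ω) i with hb
  have hmass : ∀ i ω k, IsMassFunction (b i ω k) := fun i ω k =>
    isMassFunction_belief h0 h1 hγ hL hμ₀ _ i k
  have hbint : ∀ i (F : (N → Θ → ℝ) → ℝ), Integrable (fun ω => F (b i ω)) P := by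
    intro i F
    obtain ⟨G, hG⟩ := exists_belief_eq a γ L μ₀ i
    simp only [hb, hG]
    exact integrable_comp_of_finite (hξ.measurable_history i) fun h => F (G h)
  set Λ : ℕ → N → Ω → ℝ := fun i j ω => Real.log (1 - γ j (i + 1) + γ j (i + 1) *
    (L j θ₀ (ξ j (i + 1) ω) / forecast (L j) (b i ω j) (ξ j (i + 1) ω))) with hΛ
  have hΛint : ∀ i j, Integrable (Λ i j) P := by
    intro i j
    obtain ⟨G, hG⟩ := exists_belief_eq a γ L μ₀ i
    simp only [hΛ, hb, hG]
    exact integrable_comp_of_finite ((hξ.measurable_history i).prodMk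
      (hξ.measurable j (i + 1) (by simp))) fun h : _ × Z j =>
        Real.log (1 - γ j (i + 1) + γ j (i + 1) * (L j θ₀ h.2 / forecast (L j) (G h.1 j) h.2))
  have hΛmean : ∀ i j, j ∈ C → ∫ ω, Λ i j ω ∂P = ∫ ω, ∑ z, L j θ₀ z *
      Real.log (1 - γ j (i + 1) + γ j (i + 1) * (L j θ₀ z / forecast (L j) (b i ω j) z)) ∂P := by
    intro i j hj
    obtain ⟨G, hG⟩ := exists_belief_eq a γ L μ₀ i
    have hlaw : ∀ z, P.real {ω | ξ j (i + 1) ω = z} = L j θ₀ z := by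
      intro z
      rw [measureReal_def, hξ.law j (i + 1) (by simp), hp j hj,
        ENNReal.toReal_ofReal ((hL j θ₀).1 z)]
    simp only [hΛ, hb, hG]
    rw [integral_comp_indepFun (hξ.measurable_history i) (hξ.measurable j (i + 1) (by simp))
      (hξ.indepFun_history i j) fun h z => Real.log (1 - γ j (i + 1) + γ j (i + 1) *
        (L j θ₀ z / forecast (L j) (G h j) z))]
    simp only [hlaw]
  have hgain : ∀ i, T₁ ≤ i → ∀ j ∈ C, ∀ z : Z j,
      ∫ ω, γ j (i + 1) * ((L j θ₀ z - forecast (L j) (b i ω j) z) ^ 2 / 4) ∂P ≤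
        ∫ ω, Λ i j ω ∂P := by
    intro i hi j hj z
    rw [hΛmean i j hj]
    refine integral_mono_ae
      (hbint i fun β => γ j (i + 1) * ((L j θ₀ z - forecast (L j) (β j) z) ^ 2 / 4))
      (hbint i fun β => ∑ z, L j θ₀ z * Real.log (1 - γ j (i + 1) + γ j (i + 1) *
        (L j θ₀ z / forecast (L j) (β j) z))) ?_
    filter_upwards [hgood] with ω hω
    exact le_sum_mul_log_selfAware_factor (hL j) (hmass i ω j) (hγ j (i + 1) (by simp))
      (hT₁ i hi j hj _ hω) z
  have hΛnonneg : ∀ i, T₁ ≤ i → ∀ j, 0 ≤ y j * ∫ ω, Λ i j ω ∂P := by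
    intro i hi j
    by_cases hj : j ∈ C
    · obtain ⟨ω₀⟩ : Nonempty Ω := P.nonempty_of_neZero
      -- Any signal gives a nonnegative lower bound; `ξ j 0 ω₀` only supplies an element of `Z j`.
      refine mul_nonneg (hyn j) (le_trans ?_ (hgain i hi j hj (ξ j 0 ω₀)))
      exact integral_nonneg fun ω => mul_nonneg (hγ j (i + 1) (by simp)).1 (by positivity)
    · simp [hy0 j hj]
  -- Early beliefs may be zero; since `Real.log 0 = 0`, `e` is still finite and nonpositive, and its
  -- growth is used only from `T₁` on.
  set e : ℕ → ℝ := fun i => ∫ ω, ∑ j, y j * Real.log (b i ω j θ₀) ∂P with he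
  have he0 : ∀ i, e i ≤ 0 := fun i => integral_nonpos fun ω =>
    Finset.sum_nonpos fun j _ => mul_nonpos_of_nonneg_of_nonpos (hyn j)
      (Real.log_nonpos ((hmass i ω j).1 θ₀) ((hmass i ω j).le_one θ₀))
  have hestep : ∀ i, T₁ ≤ i → e i + y k * ∫ ω, Λ i k ω ∂P ≤ e (i + 1) := by
    intro i hi
    have h : e i + ∑ j, y j * ∫ ω, Λ i j ω ∂P ≤ e (i + 1) := by
      have hYint := fun i => hbint i fun β => ∑ j, y j * Real.log (β j θ₀)
      have hΛs : Integrable (fun ω => ∑ j, y j * Λ i j ω) P :=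
        integrable_finsetSum _ fun j _ => (hΛint i j).const_mul _
      have hs : ∑ j, y j * ∫ ω, Λ i j ω ∂P = ∫ ω, ∑ j, y j * Λ i j ω ∂P := by
        rw [integral_finsetSum _ fun j _ => (hΛint i j).const_mul _]
        simp only [integral_const_mul]
      rw [hs, he, ← integral_add (hYint i) hΛs]
      refine integral_mono_ae ((hYint i).add hΛs) (hYint (i + 1)) ?_
      filter_upwards [hgood] with ω hω
      exact sum_mul_log_belief_add_le h0 h1 hclosed hy hy0 hya hγ hL hμ₀
        (fun k hk => hω k hk i) fun k hk => hT₁ i hi k hk _ hω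
    have := Finset.single_le_sum (f := fun j => y j * ∫ ω, Λ i j ω ∂P)
      (fun j _ => hΛnonneg i hi j) (Finset.mem_univ k)
    linarith
  have hgap : 0 < L k θ₀ z - L k θ z := sub_pos.2 (hz θ hθ)
  -- `K` collects the Perron weight, the lower bound on `γ`, the Hellinger constant and the squared
  -- likelihood gap at the prevailing signal.
  set K : ℝ := y k * (c * ((L k θ₀ z - L k θ z) ^ 2 / 4)) with hK
  have hKpos : 0 < K := mul_pos (hy k hk) (by positivity)
  have hlim := ae_tendsto_zero_of_integral_le_sub (f := fun i ω => K * b i ω k θ ^ 2)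
    (fun i => hbint i fun β => K * β k θ ^ 2) (fun i ω => by positivity) (T := max T₁ T₂) he0 ?_
  · filter_upwards [hlim] with ω hω
    have h := (hω.const_mul K⁻¹).sqrt
    have e2 : ∀ i, √(K⁻¹ * (K * b i ω k θ ^ 2)) = b i ω k θ := by
      intro i
      rw [inv_mul_cancel_left₀ hKpos.ne', Real.sqrt_sq ((hmass i ω k).1 θ)]
    simpa only [e2, mul_zero, Real.sqrt_zero] using h
  · intro i hi
    have hi₁ := (le_max_left _ _).trans hi
    have hi₂ := (le_max_right _ _).trans hi
    refine le_trans ?_ (le_sub_iff_add_le'.2 (hestep i hi₁))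
    refine le_trans ?_ (mul_le_mul_of_nonneg_left (hgain i hi₁ k hk z) (hyn k))
    rw [← integral_const_mul]
    refine integral_mono (hbint i fun β => K * β k θ ^ 2) (hbint i fun β => y k * (γ k (i + 1) *
      ((L k θ₀ z - forecast (L k) (β k) z) ^ 2 / 4))) fun ω => ?_
    have hm := hz.mul_le_sub_forecast (hmass i ω k) θ
    have hsq := pow_le_pow_left₀ (mul_nonneg ((hmass i ω k).1 θ) hgap.le) hm 2
    have hc' : c ≤ γ k (i + 1) := hT₂ (i + 1) (by omega)
    calc K * b i ω k θ ^ 2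
        = y k * (c * ((b i ω k θ * (L k θ₀ z - L k θ z)) ^ 2 / 4)) := by rw [hK]; ring
      _ ≤ y k * (γ k (i + 1) * ((L k θ₀ z - forecast (L k) (b i ω k) z) ^ 2 / 4)) := by
        have := hyn k
        have := hc.le.trans hc'
        gcongr

theorem theorem3 {N Θ Ω : Type*} [Fintype N] [Fintype Θ] {Z : N → Type*}
    [∀ k, Fintype (Z k)] [∀ k, MeasurableSpace (Z k)] [∀ k, DiscreteMeasurableSpace (Z k)]
    [MeasurableSpace Ω] (P : Measure Ω) [IsProbabilityMeasure P]
    {S R : ℕ} (W : WeakNetwork N S R)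
    (L : ∀ k, Θ → Z k → ℝ) (hL : ∀ k θ, IsMassFunction (L k θ))
    (θtrue : Fin S ⊕ Fin R → Θ)
    (ξ : ∀ k, ℕ → Ω → Z k) (hξ : IsSignalProcess P (fun k => L k (θtrue (W.sub k))) ξ)
    (γ : N → ℕ → ℝ) (hγ : ∀ k i, 1 ≤ i → γ k i ∈ Set.Icc (0 : ℝ) 1)
    (μ₀ : N → Θ → ℝ) (hμ₀ : ∀ k, IsMassFunction (μ₀ k))
    (s : Fin S)
    (hγs : ∀ k, W.sub k = Sum.inl s → ∃ c : ℝ, 0 < c ∧ ∀ᶠ i in atTop, c ≤ γ k i)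
    (hprior : ∃ k, W.sub k = Sum.inl s ∧ 0 < μ₀ k (θtrue (Sum.inl s)))
    (hprevailing : ∀ k, W.sub k = Sum.inl s →
      ∃ ζ : Z k, IsPrevailing (L k) (θtrue (Sum.inl s)) ζ)
    (hident : {θ | ∀ k, W.sub k = Sum.inl s → θ ∈ indistinguishable (L k) (θtrue (Sum.inl s))}
      = {θtrue (Sum.inl s)}) :
    ∀ k, W.sub k = Sum.inl s →
      ∀ᵐ ω ∂P, Tendsto
        (fun i => belief W.a γ L μ₀ (fun ℓ j => ξ ℓ j ω) i k (θtrue (Sum.inl s)))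
        atTop (𝓝 1) := by
  classical
  intro k hk
  set θ₀ := θtrue (Sum.inl s) with hθ₀
  set C : Set N := {j | W.sub j = Sum.inl s} with hC
  have hpath : ∀ k ∈ C, ∀ ℓ ∈ C, PathWithin W.a C k ℓ := fun k hk ℓ hℓ =>
    W.sending_path s k ℓ hk hℓ
  have hp : ∀ k ∈ C, L k (θtrue (W.sub k)) = L k θ₀ := fun k hk => by
    rw [show W.sub k = Sum.inl s from hk]
  have hgood : ∀ᵐ ω ∂P, ∀ k ∈ C, ∀ i, 0 < L k θ₀ (ξ k (i + 1) ω) := by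
    filter_upwards [ae_all_iff.2 fun k => hξ.ae_pos k] with ω hω k hk i
    simpa [hp k hk] using hω k i
  have hlim : ∀ᵐ ω ∂P, ∀ k θ, k ∈ C → θ ∉ indistinguishable (L k) θ₀ →
      Tendsto (fun i => belief W.a γ L μ₀ (fun ℓ j => ξ ℓ j ω) i k θ) atTop (𝓝 0) := by
    rw [ae_all_iff]
    intro k
    rw [ae_all_iff]
    intro θ
    by_cases h : k ∈ C ∧ θ ∉ indistinguishable (L k) θ₀
    · obtain ⟨z, hz⟩ := hprevailing k h.1
      filter_upwards [ae_tendsto_belief_zero W.nonneg W.sum_eq_one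
        (fun ℓ k hk hℓ => W.sending_closed s ℓ k hk hℓ) hpath (W.sending_loop s) hL hξ hp hγ hμ₀
        hprior h.1 (hγs k h.1) hz h.2] with ω hω _ _ using hω
    · exact Eventually.of_forall fun ω h₁ h₂ => absurd ⟨h₁, h₂⟩ h
  filter_upwards [hgood, hlim] with ω hω hω'
  have hzero : ∀ θ, θ ≠ θ₀ →
      Tendsto (fun i => belief W.a γ L μ₀ (fun ℓ j => ξ ℓ j ω) i k θ) atTop (𝓝 0) := by
    intro θ hθ
    refine tendsto_belief_zero_of_path W.nonneg W.sum_eq_one hpath hγ hL hμ₀ hω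
      (fun k hk h => hω' k θ hk h) ?_ hk
    -- If no agent of `C` distinguished `θ` from `θ₀`, global identifiability would force `θ = θ₀`.
    by_contra! hn
    exact hθ (hident.subset hn)
  have hsum : ∀ i, belief W.a γ L μ₀ (fun ℓ j => ξ ℓ j ω) i k θ₀ =
      1 - ∑ θ ∈ Finset.univ.erase θ₀, belief W.a γ L μ₀ (fun ℓ j => ξ ℓ j ω) i k θ := by
    intro i
    rw [eq_sub_iff_add_eq, Finset.add_sum_erase _ _ (Finset.mem_univ θ₀)]
    exact (isMassFunction_belief W.nonneg W.sum_eq_one hγ hL hμ₀ _ i k).2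
  simp_rw [hsum]
  simpa using (tendsto_finsetSum (Finset.univ.erase θ₀)
    fun θ hθ => hzero θ (Finset.ne_of_mem_erase hθ)).const_sub 1
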